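/- Let $G$ be a topological group and let $\mathcal H$ be a cofinal system of open subgroups of $G$, that is, a set of open subgroups such that every open subgroup of $G$ contains a member of $\mathcal H$. Let $A$ be a commutative ring on which $G$ acts discretely, that is, $G$ acts by ring automorphisms and the stabilizer $\{g\in G : g\cdot a=a\}$ is open for every $a\in A$. Let $AG$ be the skew group ring, with multiplication $(ag)(bh)=a(g\cdot b)\,gh$; a (left) $AG$-module $V$ is called discrete if the stabilizer $\{g\in G: g\cdot v=v\}$ is open for every $v\in V$. Let $AG\textrm{-Mod}^{\mathrm{dis}}$ be the full subcategory of $AG\textrm{-Mod}$ consisting of the discrete modules. Let $\mathcal O_G$ be the orbit category of $G$ with respect to $\mathcal H$: its objects are the $G$-sets $G/H$ with $H\in\mathcal H$, and its morphisms are the $G$-equivariant maps. Equip it with the atomic Grothendieck topology $J_{at}$, in which a sieve is covering if and only if it is nonempty. For $H,K\in\mathcal H$ a morphism $G/H\to G/K$ is determined by the image $gK$ of the coset $H$. Let $\mathcal A$ be the presheaf of commutative rings on $\mathcal O_G$ with $\mathcal A(G/H)=A^H=\{a\in A: h\cdot a=a \text{ for all } h\in H\}$, in which the morphism $G/H\to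 G/K$ with $H\mapsto gK$ induces $A^K\to A^H$, $a\mapsto g\cdot a$. Then $\mathcal A$ is a sheaf on $(\mathcal O_G,J_{at})$. Let $\mathrm{Sh}(\mathcal O_G,J_{at},\mathcal A)$ be the category of sheaves of $\mathcal A$-modules. Let $\phi: AG\textrm{-Mod}^{\mathrm{dis}}\to \mathrm{Sh}(\mathcal O_G,J_{at},\mathcal A)$ be the functor that sends $V$ to the sheaf $\mathcal V$ with $\mathcal V(G/H)=V^H$, in which the morphism $G/H\to G/K$ with $H\mapsto gK$ induces $V^K\to V^H$, $v\mapsto g\cdot v$. Let $\psi: \mathrm{Sh}(\mathcal O_G,J_{at},\mathcal A)\to AG\textrm{-Mod}^{\mathrm{dis}}$ be the functor $$\psi(\mathcal V)=\varinjlim_{H\in\mathcal H}\mathcal V(G/H),$$ the colimit being taken along the restrictions $\mathcal V(G/H)\to\mathcal V(G/L)$ for $L\leqslant H$ in $\mathcal H$, with the following action. For $v\in\mathcal V(G/H)$ and $g\in G$, $g\cdot[v]$ is the class of the restriction of $v$ along the map $G/L\to G/H$, $xL\mapsto xgH$, for any $L\in\mathcal H$ with $L\leqslant gHg^{-1}$;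 and for $a\in A$, $a\cdot[v]$ is the class of $a\cdot (v|_{G/L})$ for any $L\in\mathcal H$ with $L\leqslant H$ and $a\in A^L$. Then $\phi$ and $\psi$ are mutually quasi-inverse equivalences of categories between $AG\textrm{-Mod}^{\mathrm{dis}}$ and $\mathrm{Sh}(\mathcal O_G,J_{at},\mathcal A)$. -/

import Mathlib

open CategoryTheory Opposite

universe u

noncomputable section

namespace DiscreteModules

/-! ### Cofinal systems of open subgroups, discrete actions -/

/-- A cofinal system of open subgroups of a topological group `G`: a family of open subgroups such
that every open subgroup of `G` contains a member of the family. -/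
structure CofinalSystem (G : Type u) [Group G] [TopologicalSpace G] where
  /-- the members of the family -/
  carrier : Set (Subgroup G)
  isOpen : ∀ H ∈ carrier, IsOpen (H : Set G)
  cofinal : ∀ U : Subgroup G, IsOpen (U : Set G) → ∃ H ∈ carrier, H ≤ U

/-- `G` acts discretely on `X`: the stabilizer of every element is an open subgroup. -/
def IsDiscreteAction (G X : Type u) [Group G] [TopologicalSpace G] [MulAction G X] : Prop :=
  ∀ x : X, IsOpen (MulAction.stabilizer G x : Set G)

/-- If `x` is fixed by `K`, then `gK ↦ g • x` is a well defined function on `G ⧸ K`. -/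
def cosetSMul {G X : Type u} [Group G] [MulAction G X] {K : Subgroup G} (x : X)
    (hx : ∀ k ∈ K, k • x = x) (q : G ⧸ K) : X :=
  Quotient.liftOn' q (fun g => g • x) (fun a b h => by
    have h1 := hx _ (QuotientGroup.leftRel_apply.mp h)
    change a • x = b • x
    rw [mul_smul, inv_smul_eq_iff] at h1
    exact h1.symm)

@[simp]
theorem cosetSMul_mk {G X : Type u} [Group G] [MulAction G X] {K : Subgroup G} (x : X)
    (hx : ∀ k ∈ K, k • x = x) (g : G) : cosetSMul x hx (g : G ⧸ K) = g • x := rfl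

theorem smul_cosetSMul {G X : Type u} [Group G] [MulAction G X] {K : Subgroup G} (x : X)
    (hx : ∀ k ∈ K, k • x = x) (g : G) (q : G ⧸ K) :
    g • cosetSMul x hx q = cosetSMul x hx (g • q) := by
  induction q using QuotientGroup.induction_on with
  | H z => exact (mul_smul g z x).symm

/-! ### The orbit category and its atomic topology -/

section Orbit

variable {G : Type u} [Group G] [TopologicalSpace G]

/-- The orbit category of `G` with respect to `ℋ`. The object with underlying subgroup `H` stands
for the `G`-set `G ⧸ H`. -/
structure OrbitCategory (ℋ : CofinalSystem G) where
  /-- the subgroup `H` of the object `G ⧸ H` -/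
  subgroup : Subgroup G
  mem : subgroup ∈ ℋ.carrier

variable {ℋ : CofinalSystem G}

/-- Morphisms of the orbit category are the `G`-equivariant maps `G ⧸ H → G ⧸ K`. -/
instance : Category.{u} (OrbitCategory ℋ) where
  Hom X Y := (G ⧸ X.subgroup) →[G] (G ⧸ Y.subgroup)
  id X := MulActionHom.id G
  comp f g := MulActionHom.comp g f

namespace OrbitCategory

/-- The equivariant map underlying a morphism. -/
def toMap {X Y : OrbitCategory ℋ} (f : X ⟶ Y) : (G ⧸ X.subgroup) →[G] (G ⧸ Y.subgroup) := f

/-- The image of the trivial coset under a morphism. -/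
def base {X Y : OrbitCategory ℋ} (f : X ⟶ Y) : G ⧸ Y.subgroup :=
  toMap f ((1 : G) : G ⧸ X.subgroup)

theorem toMap_mk {X Y : OrbitCategory ℋ} (f : X ⟶ Y) (g : G) :
    toMap f (g : G ⧸ X.subgroup) = g • base f := by
  rw [base, ← map_smul, MulAction.Quotient.smul_coe, smul_eq_mul, mul_one]

theorem hom_ext {X Y : OrbitCategory ℋ} {f f' : X ⟶ Y} (h : base f = base f') : f = f' := by
  apply MulActionHom.ext
  intro q
  induction q using QuotientGroup.induction_on with
  | H z => exact (toMap_mk f z).trans ((congrArg _ h).trans (toMap_mk f' z).symm)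

theorem base_id (X : OrbitCategory ℋ) : base (𝟙 X) = ((1 : G) : G ⧸ X.subgroup) := rfl

theorem base_comp {X Y Z : OrbitCategory ℋ} (f : X ⟶ Y) (g : Y ⟶ Z) :
    base (f ≫ g) = toMap g (base f) := rfl

theorem base_comp_of_eq {X Y Z : OrbitCategory ℋ} (f : X ⟶ Y) (g : Y ⟶ Z) {x : G}
    (hx : base f = (x : G ⧸ Y.subgroup)) : base (f ≫ g) = x • base g := by
  rw [base_comp, hx, toMap_mk]

theorem smul_base {X Y : OrbitCategory ℋ} (f : X ⟶ Y) {h : G} (hh : h ∈ X.subgroup) :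
    h • base f = base f := by
  rw [← toMap_mk, base]
  congr 1
  exact (QuotientGroup.eq.mpr (by simpa using hh))

/-- The morphism `G ⧸ H → G ⧸ K`, `gH ↦ g • q`, for `q` fixed by `H`. -/
def homMk {X Y : OrbitCategory ℋ} (q : G ⧸ Y.subgroup) (hq : ∀ h ∈ X.subgroup, h • q = q) :
    X ⟶ Y :=
  show (G ⧸ X.subgroup) →[G] (G ⧸ Y.subgroup) from
    { toFun := cosetSMul q hq
      map_smul' := fun g p => (smul_cosetSMul q hq g p).symm }

@[simp]
theorem base_homMk {X Y : OrbitCategory ℋ} (q : G ⧸ Y.subgroup)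
    (hq : ∀ h ∈ X.subgroup, h • q = q) : base (homMk q hq) = q :=
  one_smul G q

/-- The projection `G ⧸ H → G ⧸ K`, `gH ↦ gK`, for `H ≤ K`. -/
def proj {X Y : OrbitCategory ℋ} (h : X.subgroup ≤ Y.subgroup) : X ⟶ Y :=
  homMk ((1 : G) : G ⧸ Y.subgroup) (fun k hk => by
    rw [MulAction.Quotient.smul_coe]
    exact QuotientGroup.eq.mpr (by simpa using h hk))

@[simp]
theorem base_proj {X Y : OrbitCategory ℋ} (h : X.subgroup ≤ Y.subgroup) :
    base (proj h) = ((1 : G) : G ⧸ Y.subgroup) := base_homMk _ _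

theorem isOpen_stabilizer [IsTopologicalGroup G] (Y : OrbitCategory ℋ) (q : G ⧸ Y.subgroup) :
    IsOpen (MulAction.stabilizer G q : Set G) := by
  induction q using QuotientGroup.induction_on with
  | H z =>
    have h : (MulAction.stabilizer G (z : G ⧸ Y.subgroup) : Set G) =
        (fun g : G => z⁻¹ * g⁻¹ * z) ⁻¹' (Y.subgroup : Set G) := by
      ext g
      simp only [SetLike.mem_coe, MulAction.mem_stabilizer_iff, Set.mem_preimage,
        MulAction.Quotient.smul_coe, smul_eq_mul]
      rw [QuotientGroup.eq, mul_inv_rev]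
    rw [h]
    exact (ℋ.isOpen _ Y.mem).preimage (by fun_prop)

/-- Every open subgroup contains the subgroup of some object. -/
theorem exists_le (U : Subgroup G) (hU : IsOpen (U : Set G)) :
    ∃ W : OrbitCategory ℋ, W.subgroup ≤ U := by
  obtain ⟨H, hH, hle⟩ := ℋ.cofinal U hU
  exact ⟨⟨H, hH⟩, hle⟩

theorem exists_hom [IsTopologicalGroup G] (Y : OrbitCategory ℋ) (q : G ⧸ Y.subgroup) :
    ∃ (W : OrbitCategory ℋ) (f : W ⟶ Y), base f = q := by
  obtain ⟨W, hW⟩ := exists_le (ℋ := ℋ) _ (isOpen_stabilizer Y q)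
  exact ⟨W, homMk q hW, base_homMk _ _⟩

theorem exists_hom₂ [IsTopologicalGroup G] (Y Z : OrbitCategory ℋ) (q : G ⧸ Y.subgroup)
    (r : G ⧸ Z.subgroup) :
    ∃ (W : OrbitCategory ℋ) (f : W ⟶ Y) (g : W ⟶ Z), base f = q ∧ base g = r := by
  obtain ⟨W, hW⟩ := exists_le (ℋ := ℋ)
    (MulAction.stabilizer G q ⊓ MulAction.stabilizer G r)
    ((isOpen_stabilizer Y q).inter (isOpen_stabilizer Z r))
  exact ⟨W, homMk q fun h hh => (hW hh).1, homMk r fun h hh => (hW hh).2,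
    base_homMk _ _, base_homMk _ _⟩

theorem exists_proj₂ (Y Z : OrbitCategory ℋ) :
    ∃ W : OrbitCategory ℋ, W.subgroup ≤ Y.subgroup ∧ W.subgroup ≤ Z.subgroup := by
  obtain ⟨W, hW⟩ := exists_le (ℋ := ℋ) (Y.subgroup ⊓ Z.subgroup)
    ((ℋ.isOpen _ Y.mem).inter (ℋ.isOpen _ Z.mem))
  exact ⟨W, hW.trans inf_le_left, hW.trans inf_le_right⟩

variable (ℋ) in
theorem rightOre [IsTopologicalGroup G] :
    GrothendieckTopology.RightOreCondition (OrbitCategory ℋ) := by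
  intro X Y Z f g
  obtain ⟨a, ha⟩ := QuotientGroup.mk_surjective (base f)
  obtain ⟨b, hb⟩ := QuotientGroup.mk_surjective (base g)
  obtain ⟨W, u, v, hu, hv⟩ := exists_hom₂ Y Z ((a⁻¹ : G) : G ⧸ Y.subgroup)
    ((b⁻¹ : G) : G ⧸ Z.subgroup)
  refine ⟨W, u, v, hom_ext ?_⟩
  rw [base_comp_of_eq u f hu, base_comp_of_eq v g hv, ← ha, ← hb]
  simp

end OrbitCategory

open OrbitCategory

variable (ℋ) in
/-- The atomic Grothendieck topology on the orbit category. -/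
def atomicTopology [IsTopologicalGroup G] : GrothendieckTopology (OrbitCategory ℋ) :=
  GrothendieckTopology.atomic (rightOre ℋ)

/-- A presheaf of the form `G ⧸ H ↦ X^H` is a sheaf for the atomic topology. -/
theorem isSheaf_of_fixedPoints [IsTopologicalGroup G] {X : Type u} [MulAction G X]
    (P : (OrbitCategory ℋ)ᵒᵖ ⥤ Type u) (i : ∀ Y : OrbitCategory ℋ, P.obj (op Y) → X)
    (hinj : ∀ Y, Function.Injective (i Y))
    (hrange : ∀ (Y : OrbitCategory ℋ) (x : X), (∀ h ∈ Y.subgroup, h • x = x) → ∃ p, i Y p = x)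
    (hmap : ∀ {Y Z : OrbitCategory ℋ} (f : Y ⟶ Z) (p : P.obj (op Z)) (g : G),
      base f = (g : G ⧸ Z.subgroup) → i Y (P.map f.op p) = g • i Z p) :
    Presheaf.IsSheaf (atomicTopology ℋ) P := by
  rw [isSheaf_iff_isSheaf_of_type]
  intro Y S hS x hx
  obtain ⟨Z, f, hf⟩ := hS
  obtain ⟨a, ha⟩ := QuotientGroup.mk_surjective (base f)
  have key : ∀ {Z' : OrbitCategory ℋ} (g : Z' ⟶ Y) (hg : S g) (b : G),
      base g = (b : G ⧸ Y.subgroup) → i Z' (x g hg) = (b * a⁻¹) • i Z (x f hf) := by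
    intro Z' g hg b hb
    obtain ⟨W, u, v, hu, hv⟩ := exists_hom₂ Z Z' ((b * a⁻¹ : G) : G ⧸ Z.subgroup)
      ((1 : G) : G ⧸ Z'.subgroup)
    have hcomm : u ≫ f = v ≫ g := by
      apply hom_ext
      rw [base_comp_of_eq u f hu, base_comp_of_eq v g hv, ← ha, hb]
      simp
    have h := congrArg (i W) (hx u v hf hg hcomm)
    rw [hmap u _ _ hu, hmap v _ _ hv, one_smul] at h
    exact h.symm
  obtain ⟨t, ht⟩ := hrange Y (a⁻¹ • i Z (x f hf)) (fun k hk => by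
    have h1 := key f hf (a * k) (by
      rw [← ha]
      exact QuotientGroup.eq.mpr (by simpa using hk))
    rw [← mul_smul]
    conv_rhs => rw [h1]
    rw [← mul_smul]
    congr 1
    group)
  refine ⟨t, ?_, ?_⟩
  · intro Z' g hg
    obtain ⟨b, hb⟩ := QuotientGroup.mk_surjective (base g)
    apply hinj
    rw [hmap g t b hb.symm, ht, key g hg b hb.symm, mul_smul]
  · intro t' ht'
    apply hinj
    have h1 := congrArg (i Z) (ht' f hf)
    rw [hmap f t' a ha.symm] at h1
    rw [ht, ← h1, inv_smul_smul]

end Orbit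

open OrbitCategory

/-! ### The structure sheaf -/

section StructureSheaf

variable {G : Type u} [Group G] (A : Type u) [CommRing A] [MulSemiringAction G A]

/-- The subring `A^H` of elements fixed by `H`. -/
def fixedSubring (H : Subgroup G) : Subring A where
  carrier := {a | ∀ h ∈ H, h • a = a}
  mul_mem' ha hb h hh := by rw [smul_mul', ha h hh, hb h hh]
  one_mem' h _ := smul_one h
  add_mem' ha hb h hh := by rw [smul_add, ha h hh, hb h hh]
  zero_mem' h _ := smul_zero h
  neg_mem' ha h hh := by rw [smul_neg, ha h hh]

variable {A} in
theorem smul_fixedSubring {H : Subgroup G} (a : fixedSubring A H) : ∀ h ∈ H, h • (a : A) = a :=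
  a.2

variable [TopologicalSpace G] (ℋ : CofinalSystem G)

variable {ℋ} in
/-- The ring homomorphism `A^K → A^H`, `a ↦ g • a`, induced by the morphism `G ⧸ H → G ⧸ K` that
sends the coset `H` to the coset `gK`. -/
def fixedSubringMap {X Y : OrbitCategory ℋ} (f : X ⟶ Y) :
    fixedSubring A Y.subgroup →+* fixedSubring A X.subgroup where
  toFun a := ⟨cosetSMul (a : A) (smul_fixedSubring a) (base f), fun h hh => by
    rw [smul_cosetSMul, smul_base f hh]⟩
  map_one' := by
    obtain ⟨g, hg⟩ := QuotientGroup.mk_surjective (base f)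
    apply Subtype.ext
    simp [← hg]
  map_zero' := by
    obtain ⟨g, hg⟩ := QuotientGroup.mk_surjective (base f)
    apply Subtype.ext
    simp [← hg]
  map_mul' a b := by
    obtain ⟨g, hg⟩ := QuotientGroup.mk_surjective (base f)
    apply Subtype.ext
    simp [← hg]
  map_add' a b := by
    obtain ⟨g, hg⟩ := QuotientGroup.mk_surjective (base f)
    apply Subtype.ext
    simp [← hg]

theorem coe_fixedSubringMap {X Y : OrbitCategory ℋ} (f : X ⟶ Y) (a : fixedSubring A Y.subgroup)
    {g : G} (hg : base f = (g : G ⧸ Y.subgroup)) :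
    (fixedSubringMap A f a : A) = g • (a : A) := by
  change cosetSMul (a : A) (smul_fixedSubring a) (base f) = _
  rw [hg, cosetSMul_mk]

/-- The presheaf of (commutative) rings `G ⧸ H ↦ A^H` on the orbit category. -/
def structurePresheaf : (OrbitCategory ℋ)ᵒᵖ ⥤ RingCat.{u} where
  obj X := RingCat.of (fixedSubring A X.unop.subgroup)
  map f := RingCat.ofHom (fixedSubringMap A f.unop)
  map_id X := by
    ext a
    exact (coe_fixedSubringMap A ℋ (𝟙 X.unop) a (base_id _)).trans (one_smul G a.1)
  map_comp {X Y Z} f g := by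
    ext a
    obtain ⟨x, hx⟩ := QuotientGroup.mk_surjective (base f.unop)
    obtain ⟨y, hy⟩ := QuotientGroup.mk_surjective (base g.unop)
    change (fixedSubringMap A (g.unop ≫ f.unop) a : A) =
      fixedSubringMap A g.unop (fixedSubringMap A f.unop a)
    rw [coe_fixedSubringMap A ℋ g.unop _ hy.symm, coe_fixedSubringMap A ℋ f.unop a hx.symm,
      coe_fixedSubringMap A ℋ (g.unop ≫ f.unop) a (g := y * x), mul_smul]
    rw [base_comp_of_eq _ _ hy.symm, ← hx, MulAction.Quotient.smul_coe, smul_eq_mul]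

/-- The structure sheaf `𝒜` on the atomic site of the orbit category, `𝒜(G ⧸ H) = A^H`. -/
def structureSheaf [IsTopologicalGroup G] : Sheaf (atomicTopology ℋ) RingCat.{u} :=
  ⟨structurePresheaf A ℋ, by
    rw [Presheaf.isSheaf_iff_isSheaf_forget _ _ (forget RingCat.{u})]
    refine isSheaf_of_fixedPoints (X := A) _
      (fun Y (p : fixedSubring A Y.subgroup) => (p : A)) ?_ ?_ ?_
    · intro Y a b h
      exact Subtype.ext h
    · intro Y x hx
      exact ⟨(⟨x, hx⟩ : fixedSubring A Y.subgroup), rfl⟩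
    · intro Y Z f p g hg
      exact coe_fixedSubringMap A ℋ f p hg⟩

end StructureSheaf

/-! ### Discrete modules over the skew group ring -/

section Modules

variable (G A : Type u) [Group G] [CommRing A] [MulSemiringAction G A]

/-- The skew group ring `AG`, with multiplication `(a g) (b h) = (a (g • b)) (g h)`. -/
abbrev SkewGroupRing : Type u := SkewMonoidAlgebra A G

variable {G A}

theorem single_mul_single_eq (g h : G) (a b : A) :
    (SkewMonoidAlgebra.single g a * SkewMonoidAlgebra.single h b : SkewGroupRing G A) =
      SkewMonoidAlgebra.single (g * h) (a * g • b) :=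
  SkewMonoidAlgebra.single_mul_single

/-- The action of `G` on an `AG`-module. -/
instance groupAction (V : ModuleCat.{u} (SkewGroupRing G A)) : DistribMulAction G V :=
  DistribMulAction.compHom V (SkewMonoidAlgebra.of A G)

/-- The `A`-module underlying an `AG`-module. -/
instance coeffAction (V : ModuleCat.{u} (SkewGroupRing G A)) : Module A V :=
  Module.compHom V (SkewMonoidAlgebra.singleOneRingHom : A →+* SkewGroupRing G A)

theorem group_smul_def {V : ModuleCat.{u} (SkewGroupRing G A)} (g : G) (v : V) :
    g • v = (SkewMonoidAlgebra.single g 1 : SkewGroupRing G A) • v := rfl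

theorem coeff_smul_def {V : ModuleCat.{u} (SkewGroupRing G A)} (a : A) (v : V) :
    a • v = (SkewMonoidAlgebra.single 1 a : SkewGroupRing G A) • v := rfl

theorem group_smul_coeff_smul {V : ModuleCat.{u} (SkewGroupRing G A)} (g : G) (a : A) (v : V) :
    g • (a • v) = (g • a) • (g • v) := by
  simp only [group_smul_def, coeff_smul_def, smul_smul, single_mul_single_eq]
  simp

theorem single_smul_eq {V : ModuleCat.{u} (SkewGroupRing G A)} (g : G) (a : A) (v : V) :
    (SkewMonoidAlgebra.single g a : SkewGroupRing G A) • v = a • (g • v) := by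
  simp only [group_smul_def, coeff_smul_def, smul_smul, single_mul_single_eq]
  simp

theorem map_group_smul {V W : ModuleCat.{u} (SkewGroupRing G A)} (α : V ⟶ W) (g : G) (v : V) :
    α.hom (g • v) = g • α.hom v :=
  α.hom.map_smul _ v

theorem map_coeff_smul {V W : ModuleCat.{u} (SkewGroupRing G A)} (α : V ⟶ W) (a : A) (v : V) :
    α.hom (a • v) = a • α.hom v :=
  α.hom.map_smul _ v

variable (G A) in
/-- The property of an `AG`-module of being discrete. -/
def isDiscrete [TopologicalSpace G] : ObjectProperty (ModuleCat.{u} (SkewGroupRing G A)) :=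
  fun V => IsDiscreteAction G V

variable (G A) in
/-- The category of discrete `AG`-modules, a full subcategory of the category of
`AG`-modules. -/
abbrev DiscreteModuleCat [TopologicalSpace G] := (isDiscrete G A).FullSubcategory

/-! ### The functor `φ` -/

/-- The `A^H`-module `V^H` of elements of `V` fixed by `H`. -/
def fixedSubmodule (V : ModuleCat.{u} (SkewGroupRing G A)) (H : Subgroup G) :
    Submodule (fixedSubring A H) V where
  carrier := {v | ∀ h ∈ H, h • v = v}
  add_mem' ha hb h hh := by rw [smul_add, ha h hh, hb h hh]
  zero_mem' h _ := smul_zero h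
  smul_mem' a v hv h hh := by
    change h • ((a : A) • v) = (a : A) • v
    rw [group_smul_coeff_smul, smul_fixedSubring a h hh, hv h hh]

theorem smul_fixedSubmodule {V : ModuleCat.{u} (SkewGroupRing G A)} {H : Subgroup G}
    (v : fixedSubmodule V H) : ∀ h ∈ H, h • (v : V) = v :=
  v.2

variable [TopologicalSpace G] (ℋ : CofinalSystem G)

variable {ℋ} in
/-- The map `V^K → V^H`, `v ↦ g • v`, induced by the morphism `G ⧸ H → G ⧸ K` that sends the coset
`H` to the coset `gK`. -/
def fixedSubmoduleMap (V : ModuleCat.{u} (SkewGroupRing G A)) {X Y : OrbitCategory ℋ} (f : X ⟶ Y) :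
    fixedSubmodule V Y.subgroup →+ fixedSubmodule V X.subgroup where
  toFun v := ⟨cosetSMul (v : V) (smul_fixedSubmodule v) (base f), fun h hh => by
    rw [smul_cosetSMul, smul_base f hh]⟩
  map_zero' := by
    obtain ⟨g, hg⟩ := QuotientGroup.mk_surjective (base f)
    apply Subtype.ext
    simp [← hg]
  map_add' a b := by
    obtain ⟨g, hg⟩ := QuotientGroup.mk_surjective (base f)
    apply Subtype.ext
    simp [← hg]

variable {ℋ} in
theorem coe_fixedSubmoduleMap (V : ModuleCat.{u} (SkewGroupRing G A)) {X Y : OrbitCategory ℋ}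
    (f : X ⟶ Y) (v : fixedSubmodule V Y.subgroup) {g : G}
    (hg : base f = (g : G ⧸ Y.subgroup)) :
    (fixedSubmoduleMap V f v : V) = g • (v : V) := by
  change cosetSMul (v : V) (smul_fixedSubmodule v) (base f) = _
  rw [hg, cosetSMul_mk]

/-- The presheaf of abelian groups `G ⧸ H ↦ V^H`. -/
def fixedAbPresheaf (V : ModuleCat.{u} (SkewGroupRing G A)) :
    (OrbitCategory ℋ)ᵒᵖ ⥤ Ab.{u} where
  obj X := AddCommGrpCat.of (fixedSubmodule V X.unop.subgroup)
  map f := AddCommGrpCat.ofHom (fixedSubmoduleMap V f.unop)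
  map_id X := by
    ext a
    exact (coe_fixedSubmoduleMap V (𝟙 X.unop) a (base_id _)).trans (one_smul G a.1)
  map_comp {X Y Z} f g := by
    ext a
    obtain ⟨x, hx⟩ := QuotientGroup.mk_surjective (base f.unop)
    obtain ⟨y, hy⟩ := QuotientGroup.mk_surjective (base g.unop)
    change (fixedSubmoduleMap V (g.unop ≫ f.unop) a : V) =
      fixedSubmoduleMap V g.unop (fixedSubmoduleMap V f.unop a)
    rw [coe_fixedSubmoduleMap V g.unop _ hy.symm, coe_fixedSubmoduleMap V f.unop a hx.symm,
      coe_fixedSubmoduleMap V (g.unop ≫ f.unop) a (g := y * x), mul_smul]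
    rw [base_comp_of_eq _ _ hy.symm, ← hx, MulAction.Quotient.smul_coe, smul_eq_mul]

instance (V : ModuleCat.{u} (SkewGroupRing G A)) (X : (OrbitCategory ℋ)ᵒᵖ) :
    Module ((structurePresheaf A ℋ).obj X) ((fixedAbPresheaf ℋ V).obj X) :=
  inferInstanceAs (Module (fixedSubring A X.unop.subgroup) (fixedSubmodule V X.unop.subgroup))

/-- The presheaf of `𝒜`-modules `G ⧸ H ↦ V^H`. -/
def fixedPresheaf (V : ModuleCat.{u} (SkewGroupRing G A)) :
    PresheafOfModules.{u} (structurePresheaf A ℋ) :=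
  PresheafOfModules.ofPresheaf (fixedAbPresheaf ℋ V) (by
    intro X Y f (r : fixedSubring A X.unop.subgroup) (m : fixedSubmodule V X.unop.subgroup)
    apply Subtype.ext
    obtain ⟨x, hx⟩ := QuotientGroup.mk_surjective (base f.unop)
    change (fixedSubmoduleMap V f.unop (r • m) : V) =
      (fixedSubringMap A f.unop r : A) • (fixedSubmoduleMap V f.unop m : V)
    rw [coe_fixedSubmoduleMap V f.unop _ hx.symm, coe_fixedSubmoduleMap V f.unop _ hx.symm,
      coe_fixedSubringMap A ℋ f.unop _ hx.symm, ← group_smul_coeff_smul]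
    rfl)

theorem fixedPresheaf_isSheaf [IsTopologicalGroup G] (V : ModuleCat.{u} (SkewGroupRing G A)) :
    Presheaf.IsSheaf (atomicTopology ℋ) (fixedPresheaf ℋ V).presheaf := by
  rw [Presheaf.isSheaf_iff_isSheaf_forget _ _ (forget Ab.{u})]
  refine isSheaf_of_fixedPoints (X := V) _
    (fun Y (p : fixedSubmodule V Y.subgroup) => (p : V)) ?_ ?_ ?_
  · intro Y a b h
    exact Subtype.ext h
  · intro Y x hx
    exact ⟨(⟨x, hx⟩ : fixedSubmodule V Y.subgroup), rfl⟩
  · intro Y Z f p g hg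
    exact coe_fixedSubmoduleMap V f p hg

/-- The restriction `V^H → W^H` of a homomorphism `V → W`. -/
def fixedSubmoduleHom {V W : ModuleCat.{u} (SkewGroupRing G A)} (α : V ⟶ W) (H : Subgroup G) :
    fixedSubmodule V H →ₗ[fixedSubring A H] fixedSubmodule W H where
  toFun v := ⟨α.hom v.1, fun h hh => by rw [← map_group_smul, v.2 h hh]⟩
  map_add' v w := Subtype.ext (map_add α.hom v.1 w.1)
  map_smul' a v := Subtype.ext (map_coeff_smul α a.1 v.1)

/-- The functor `φ` from discrete `AG`-modules to sheaves of `𝒜`-modules, sending `V` to the sheaf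
`G ⧸ H ↦ V^H`. -/
def fixedPointsFunctor [IsTopologicalGroup G] :
    DiscreteModuleCat G A ⥤ SheafOfModules.{u} (structureSheaf A ℋ) where
  obj V := ⟨fixedPresheaf ℋ V.obj, fixedPresheaf_isSheaf ℋ V.obj⟩
  map {V W} α := ⟨
    { app := fun X => ModuleCat.ofHom (fixedSubmoduleHom α.hom X.unop.subgroup)
      naturality := fun {X Y} f => by
        ext (v : fixedSubmodule V.obj X.unop.subgroup)
        apply Subtype.ext
        obtain ⟨x, hx⟩ := QuotientGroup.mk_surjective (base f.unop)
        change α.hom.hom (fixedSubmoduleMap V.obj f.unop v : V.obj) =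
          (fixedSubmoduleMap W.obj f.unop (fixedSubmoduleHom α.hom X.unop.subgroup v) : W.obj)
        rw [coe_fixedSubmoduleMap _ f.unop _ hx.symm, coe_fixedSubmoduleMap _ f.unop _ hx.symm]
        exact map_group_smul _ _ _ }⟩
  map_id V := rfl
  map_comp f g := rfl

end Modules

/-! ### The functor `ψ` -/

section Colimit

variable {G : Type u} [Group G] [TopologicalSpace G]

/-- The members of `ℋ`, ordered by reverse inclusion. -/
abbrev CofinalSystem.Index (ℋ : CofinalSystem G) : Type u := (ℋ.carrier)ᵒᵈ

/-- The object `G ⧸ H` of the orbit category attached to a member `H` of `ℋ`. -/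
def CofinalSystem.Index.orbit {ℋ : CofinalSystem G} (i : ℋ.Index) : OrbitCategory ℋ :=
  ⟨(OrderDual.ofDual i).1, (OrderDual.ofDual i).2⟩

/-- The projection `G ⧸ L → G ⧸ H` for `L ≤ H`. -/
def CofinalSystem.Index.proj {ℋ : CofinalSystem G} {i j : ℋ.Index} (h : i ≤ j) :
    j.orbit ⟶ i.orbit :=
  OrbitCategory.proj (X := j.orbit) (Y := i.orbit) h

theorem CofinalSystem.Index.base_proj {ℋ : CofinalSystem G} {i j : ℋ.Index} (h : i ≤ j) :
    base (CofinalSystem.Index.proj h) = ((1 : G) : G ⧸ i.orbit.subgroup) :=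
  OrbitCategory.base_proj _

/-- The member of `ℋ` attached to an object of the orbit category. -/
def OrbitCategory.index {ℋ : CofinalSystem G} (X : OrbitCategory ℋ) : ℋ.Index :=
  OrderDual.toDual ⟨X.subgroup, X.mem⟩

instance (ℋ : CofinalSystem G) : IsDirectedOrder ℋ.Index where
  directed i j := by
    obtain ⟨W, h1, h2⟩ := exists_proj₂ i.orbit j.orbit
    exact ⟨W.index, h1, h2⟩

instance (ℋ : CofinalSystem G) : Nonempty ℋ.Index := by
  obtain ⟨W, -⟩ := exists_le (ℋ := ℋ) ⊤ isOpen_univ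
  exact ⟨W.index⟩

variable {A : Type u} [CommRing A] [MulSemiringAction G A] {ℋ : CofinalSystem G}
variable (M M' : PresheafOfModules.{u} (structurePresheaf A ℋ))

instance coeffModule (X : OrbitCategory ℋ) : Module (fixedSubring A X.subgroup) (M.obj (op X)) :=
  inferInstanceAs (Module ((structurePresheaf A ℋ).obj (op X)) (M.obj (op X)))

/-- The restriction map `M(G ⧸ K) → M(G ⧸ H)` along a morphism `G ⧸ H → G ⧸ K`. -/
def res {X Y : OrbitCategory ℋ} (f : X ⟶ Y) : M.obj (op Y) →+ M.obj (op X) :=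
  (M.presheaf.map f.op).hom

theorem res_id (X : OrbitCategory ℋ) (v : M.obj (op X)) : res M (𝟙 X) v = v :=
  ConcreteCategory.congr_hom (M.presheaf.map_id (op X)) v

theorem res_comp {X Y Z : OrbitCategory ℋ} (f : X ⟶ Y) (g : Y ⟶ Z) (v : M.obj (op Z)) :
    res M (f ≫ g) v = res M f (res M g v) :=
  ConcreteCategory.congr_hom (M.presheaf.map_comp g.op f.op) v

theorem res_smul {X Y : OrbitCategory ℋ} (f : X ⟶ Y) (a : fixedSubring A Y.subgroup)
    (v : M.obj (op Y)) : res M f (a • v) = fixedSubringMap A f a • res M f v :=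
  M.map_smul f.op a v

theorem app_res {M M' : PresheafOfModules.{u} (structurePresheaf A ℋ)} (α : M ⟶ M')
    {X Y : OrbitCategory ℋ} (f : X ⟶ Y) (v : M.obj (op Y)) :
    α.app (op X) (res M f v) = res M' f (α.app (op Y) v) :=
  PresheafOfModules.naturality_apply α f.op v

/-- The transition map `M(G ⧸ H) → M(G ⧸ L)` for `L ≤ H`. -/
def transition (i j : ℋ.Index) (h : i ≤ j) : M.obj (op i.orbit) →+ M.obj (op j.orbit) :=
  res M (CofinalSystem.Index.proj h)

instance : DirectedSystem (fun i : ℋ.Index => M.obj (op i.orbit))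
    (fun i j h => transition M i j h) where
  map_self i v := by
    have h : CofinalSystem.Index.proj (le_refl i) = 𝟙 _ :=
      hom_ext (CofinalSystem.Index.base_proj _)
    exact (congrArg (fun f => res M f v) h).trans (res_id M _ v)
  map_map k j i hij hjk v := by
    have h : CofinalSystem.Index.proj hjk ≫ CofinalSystem.Index.proj hij =
        CofinalSystem.Index.proj (hij.trans hjk) := by
      apply hom_ext
      rw [base_comp_of_eq _ _ (CofinalSystem.Index.base_proj _), one_smul,
        CofinalSystem.Index.base_proj, CofinalSystem.Index.base_proj]
    exact (res_comp M _ _ v).symm.trans (congrArg (fun f => res M f v) h)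

/-- The colimit of `M(G ⧸ H)` over `H ∈ ℋ`, along the restriction maps for `L ≤ H`. -/
def Stalk : Type u :=
  DirectLimit (fun i : ℋ.Index => M.obj (op i.orbit)) (transition M)

instance : AddCommGroup (Stalk M) :=
  inferInstanceAs
    (AddCommGroup (DirectLimit (fun i : ℋ.Index => M.obj (op i.orbit)) (transition M)))

/-- The class in the colimit of an element of `M(G ⧸ H)`. -/
def germ (X : OrbitCategory ℋ) (v : M.obj (op X)) : Stalk M :=
  Quotient.mk _ ⟨X.index, v⟩

theorem germ_add (X : OrbitCategory ℋ) (v w : M.obj (op X)) :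
    germ M X (v + w) = germ M X v + germ M X w :=
  (DirectLimit.add_def (G := fun i : ℋ.Index => M.obj (op i.orbit)) (f := transition M)
    X.index v w).symm

theorem germ_res {X Y : OrbitCategory ℋ} (f : X ⟶ Y)
    (hf : base f = ((1 : G) : G ⧸ Y.subgroup)) (v : M.obj (op Y)) :
    germ M X (res M f v) = germ M Y v := by
  have hle : X.subgroup ≤ Y.subgroup := by
    intro h hh
    have h1 := smul_base f hh
    rw [hf, MulAction.Quotient.smul_coe, QuotientGroup.eq] at h1
    simpa using h1
  obtain rfl : f = proj hle := hom_ext (by rw [hf, base_proj])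
  exact DirectLimit.mk_apply (F := fun i : ℋ.Index => M.obj (op i.orbit)) (f := transition M)
    Y.index X.index v hle

/-- The class of a restriction of `v` depends only on the image of the trivial coset. -/
theorem germ_res_eq {X X' Y : OrbitCategory ℋ} (f : X ⟶ Y) (f' : X' ⟶ Y) (h : base f = base f')
    (v : M.obj (op Y)) : germ M X (res M f v) = germ M X' (res M f' v) := by
  obtain ⟨W, h1, h2⟩ := exists_proj₂ X X'
  rw [← germ_res M (proj h1) (base_proj _), ← germ_res M (proj h2) (base_proj _), ← res_comp,
    ← res_comp]
  congr 3
  apply hom_ext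
  rw [base_comp_of_eq _ _ (base_proj _), base_comp_of_eq _ _ (base_proj _), h]

theorem exists_germ (s : Stalk M) : ∃ (X : OrbitCategory ℋ) (v : M.obj (op X)), germ M X v = s := by
  obtain ⟨i, v, h⟩ := DirectLimit.exists_eq_mk (F := fun i : ℋ.Index => M.obj (op i.orbit))
    (transition M) s
  exact ⟨i.orbit, v, h.symm⟩

/-- A class can be represented on a subgroup contained in a given open subgroup. -/
theorem exists_germ_le (U : Subgroup G) (hU : IsOpen (U : Set G)) (s : Stalk M) :
    ∃ (X : OrbitCategory ℋ) (v : M.obj (op X)), X.subgroup ≤ U ∧ germ M X v = s := by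
  obtain ⟨Y, v, rfl⟩ := exists_germ M s
  obtain ⟨W, hW⟩ := exists_le (ℋ := ℋ) (Y.subgroup ⊓ U) ((ℋ.isOpen _ Y.mem).inter hU)
  exact ⟨W, res M (proj (hW.trans inf_le_left)) v, hW.trans inf_le_right,
    germ_res M _ (base_proj _) v⟩

theorem exists_germ₂ (U : Subgroup G) (hU : IsOpen (U : Set G)) (s t : Stalk M) :
    ∃ (X : OrbitCategory ℋ) (v w : M.obj (op X)), X.subgroup ≤ U ∧ germ M X v = s ∧
      germ M X w = t := by
  obtain ⟨Y, v, hY, rfl⟩ := exists_germ_le M U hU s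
  obtain ⟨Z, w, -, rfl⟩ := exists_germ_le M U hU t
  obtain ⟨W, h1, h2⟩ := exists_proj₂ Y Z
  exact ⟨W, res M (proj h1) v, res M (proj h2) w, h1.trans hY,
    germ_res M _ (base_proj _) v, germ_res M _ (base_proj _) w⟩

/-- Maps out of the colimit. -/
def stalkLift {T : Type u} (F : ∀ X : OrbitCategory ℋ, M.obj (op X) → T)
    (hF : ∀ {X Y : OrbitCategory ℋ} (f : X ⟶ Y), base f = ((1 : G) : G ⧸ Y.subgroup) →
      ∀ v, F Y v = F X (res M f v)) (s : Stalk M) : T :=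
  DirectLimit.lift (transition M) (fun i v => F (CofinalSystem.Index.orbit i) v)
    (fun _ _ h v => hF _ (CofinalSystem.Index.base_proj h) v) s

theorem stalkLift_germ {T : Type u} (F : ∀ X : OrbitCategory ℋ, M.obj (op X) → T)
    (hF : ∀ {X Y : OrbitCategory ℋ} (f : X ⟶ Y), base f = ((1 : G) : G ⧸ Y.subgroup) →
      ∀ v, F Y v = F X (res M f v)) (X : OrbitCategory ℋ) (v : M.obj (op X)) :
    stalkLift M F hF (germ M X v) = F X v := rfl

/-! #### The action of `G` on the colimit -/

section GroupAction

variable [IsTopologicalGroup G]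

/-- A chosen `G ⧸ L` together with a map `G ⧸ L → G ⧸ H` sending the coset `L` to `gH`. -/
def translateObj (g : G) (X : OrbitCategory ℋ) : OrbitCategory ℋ :=
  (exists_hom X (g : G ⧸ X.subgroup)).choose

/-- The map `G ⧸ L → G ⧸ H`, `xL ↦ xgH`. -/
def translate (g : G) (X : OrbitCategory ℋ) : translateObj g X ⟶ X :=
  (exists_hom X (g : G ⧸ X.subgroup)).choose_spec.choose

theorem base_translate (g : G) (X : OrbitCategory ℋ) :
    base (translate g X) = (g : G ⧸ X.subgroup) :=
  (exists_hom X (g : G ⧸ X.subgroup)).choose_spec.choose_spec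

/-- `g` sends the class of `v ∈ M(G ⧸ H)` to the class of its restriction along
`G ⧸ L → G ⧸ H`, `xL ↦ xgH`, for any `L ∈ ℋ` contained in `gHg⁻¹`
(see `stalkGroupSMul_germ`). -/
def stalkGroupSMul (g : G) : Stalk M → Stalk M :=
  stalkLift M (fun X v => germ M _ (res M (translate g X) v)) (fun {X Y} f hf v => by
    rw [← res_comp]
    apply germ_res_eq
    rw [base_comp_of_eq _ _ (base_translate g X), hf, base_translate]
    simp)

theorem stalkGroupSMul_germ (g : G) {X Y : OrbitCategory ℋ} (f : X ⟶ Y)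
    (hf : base f = (g : G ⧸ Y.subgroup)) (v : M.obj (op Y)) :
    stalkGroupSMul M g (germ M Y v) = germ M X (res M f v) :=
  germ_res_eq M _ _ ((base_translate g Y).trans hf.symm) v

instance stalkGroupAction : DistribMulAction G (Stalk M) where
  smul := stalkGroupSMul M
  one_smul s := by
    obtain ⟨X, v, rfl⟩ := exists_germ M s
    exact (stalkGroupSMul_germ M 1 (𝟙 X) (base_id X) v).trans (by rw [res_id])
  mul_smul g h s := by
    obtain ⟨X, v, rfl⟩ := exists_germ M s
    obtain ⟨Y, f, hf⟩ := exists_hom X (h : G ⧸ X.subgroup)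
    obtain ⟨Z, k, hk⟩ := exists_hom Y (g : G ⧸ Y.subgroup)
    change stalkGroupSMul M (g * h) _ = stalkGroupSMul M g (stalkGroupSMul M h _)
    rw [stalkGroupSMul_germ M h f hf, stalkGroupSMul_germ M g k hk, ← res_comp]
    apply stalkGroupSMul_germ
    rw [base_comp_of_eq _ _ hk, hf]
    simp
  smul_zero g := by
    obtain ⟨X, v, hv⟩ := exists_germ M (0 : Stalk M)
    obtain ⟨Y, f, hf⟩ := exists_hom X (g : G ⧸ X.subgroup)
    have h0 : ∀ Z, germ M Z 0 = 0 := fun Z => by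
      have h := germ_add M Z 0 0
      rwa [add_zero, left_eq_add] at h
    change stalkGroupSMul M g 0 = 0
    conv_lhs => rw [← h0 X]
    rw [stalkGroupSMul_germ M g f hf, map_zero, h0]
  smul_add g s t := by
    obtain ⟨X, v, w, -, rfl, rfl⟩ := exists_germ₂ M ⊤ isOpen_univ s t
    obtain ⟨Y, f, hf⟩ := exists_hom X (g : G ⧸ X.subgroup)
    change stalkGroupSMul M g _ = stalkGroupSMul M g _ + stalkGroupSMul M g _
    rw [← germ_add, stalkGroupSMul_germ M g f hf, stalkGroupSMul_germ M g f hf,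
      stalkGroupSMul_germ M g f hf, map_add, germ_add]

theorem smul_germ (g : G) {X Y : OrbitCategory ℋ} (f : X ⟶ Y)
    (hf : base f = (g : G ⧸ Y.subgroup)) (v : M.obj (op Y)) :
    g • germ M Y v = germ M X (res M f v) := stalkGroupSMul_germ M g f hf v

theorem smul_germ_of_mem {X : OrbitCategory ℋ} {g : G} (hg : g ∈ X.subgroup)
    (v : M.obj (op X)) : g • germ M X v = germ M X v := by
  rw [smul_germ M g (𝟙 X) (by
    rw [base_id]
    exact QuotientGroup.eq.mpr (by simpa using hg)), res_id]

theorem stalk_isDiscreteAction : IsDiscreteAction G (Stalk M) := by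
  intro s
  obtain ⟨X, v, rfl⟩ := exists_germ M s
  exact Subgroup.isOpen_mono (H₁ := X.subgroup) (fun g hg => smul_germ_of_mem M hg v)
    (ℋ.isOpen _ X.mem)

end GroupAction

/-! #### The `A`-module structure on the colimit -/

section CoeffAction

theorem germ_coeff_eq {X Y Z : OrbitCategory ℋ} (p : X ⟶ Z) (q : Y ⟶ Z)
    (hp : base p = base q) (a : A)
    (haX : a ∈ fixedSubring A X.subgroup) (haY : a ∈ fixedSubring A Y.subgroup)
    (v : M.obj (op Z)) :
    germ M X ((⟨a, haX⟩ : fixedSubring A X.subgroup) • res M p v) =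
      germ M Y ((⟨a, haY⟩ : fixedSubring A Y.subgroup) • res M q v) := by
  obtain ⟨W, h1, h2⟩ := exists_proj₂ X Y
  rw [← germ_res M (proj h1) (base_proj _), ← germ_res M (proj h2) (base_proj _), res_smul,
    res_smul, ← res_comp, ← res_comp]
  have hpq : proj h1 ≫ p = proj h2 ≫ q := by
    apply hom_ext
    rw [base_comp_of_eq _ _ (base_proj _), base_comp_of_eq _ _ (base_proj _), hp]
  rw [hpq]
  congr 2

theorem exists_coeff (hA : IsDiscreteAction G A) (a : A) (X : OrbitCategory ℋ) :
    ∃ W : OrbitCategory ℋ, W.subgroup ≤ X.subgroup ∧ a ∈ fixedSubring A W.subgroup := by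
  obtain ⟨W, hW⟩ := exists_le (ℋ := ℋ) (X.subgroup ⊓ MulAction.stabilizer G a)
    ((ℋ.isOpen _ X.mem).inter (hA a))
  exact ⟨W, hW.trans inf_le_left, fun h hh => (hW hh).2⟩

/-- `a` sends the class of `v ∈ M(G ⧸ H)` to the class of `a • v|_L ∈ M(G ⧸ L)`, for any `L ∈ ℋ`
contained in `H` such that `a ∈ A^L` (see `stalkCoeffSMul_germ`). -/
def stalkCoeffSMul (hA : IsDiscreteAction G A) (a : A) : Stalk M → Stalk M :=
  stalkLift M
    (fun X v => germ M (exists_coeff hA a X).choose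
      ((⟨a, (exists_coeff hA a X).choose_spec.2⟩ : fixedSubring A _) •
        res M (proj (exists_coeff hA a X).choose_spec.1) v))
    (fun {X Y} f hf v => by
      rw [← res_comp]
      apply germ_coeff_eq
      rw [base_comp_of_eq _ _ (base_proj _), hf, base_proj]
      simp)

theorem stalkCoeffSMul_germ (hA : IsDiscreteAction G A) (a : A) {X Y : OrbitCategory ℋ}
    (f : X ⟶ Y) (hf : base f = ((1 : G) : G ⧸ Y.subgroup)) (ha : a ∈ fixedSubring A X.subgroup)
    (v : M.obj (op Y)) :
    stalkCoeffSMul M hA a (germ M Y v) =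
      germ M X ((⟨a, ha⟩ : fixedSubring A X.subgroup) • res M f v) :=
  germ_coeff_eq M _ _ ((base_proj _).trans hf.symm) a _ _ v

theorem stalkCoeffSMul_germ_self (hA : IsDiscreteAction G A) (a : A) (X : OrbitCategory ℋ)
    (ha : a ∈ fixedSubring A X.subgroup) (v : M.obj (op X)) :
    stalkCoeffSMul M hA a (germ M X v) =
      germ M X ((⟨a, ha⟩ : fixedSubring A X.subgroup) • v) := by
  rw [stalkCoeffSMul_germ M hA a (𝟙 X) (base_id X) ha, res_id]

/-- The `A`-module structure on the colimit. -/
abbrev stalkModule (hA : IsDiscreteAction G A) : Module A (Stalk M) where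
  smul := stalkCoeffSMul M hA
  one_smul s := by
    obtain ⟨X, v, rfl⟩ := exists_germ M s
    refine (stalkCoeffSMul_germ_self M hA 1 X (one_mem _) v).trans ?_
    exact congrArg _ (one_smul (fixedSubring A X.subgroup) v)
  mul_smul a b s := by
    obtain ⟨X, v, hX, rfl⟩ := exists_germ_le M
      (MulAction.stabilizer G a ⊓ MulAction.stabilizer G b) ((hA a).inter (hA b)) s
    have ha : a ∈ fixedSubring A X.subgroup := fun h hh => (hX hh).1
    have hb : b ∈ fixedSubring A X.subgroup := fun h hh => (hX hh).2
    change stalkCoeffSMul M hA (a * b) _ = stalkCoeffSMul M hA a (stalkCoeffSMul M hA b _)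
    rw [stalkCoeffSMul_germ_self M hA b X hb, stalkCoeffSMul_germ_self M hA a X ha,
      stalkCoeffSMul_germ_self M hA (a * b) X (mul_mem ha hb), ← mul_smul]
    rfl
  smul_zero a := by
    have h0 : ∀ X, germ M X 0 = 0 := fun X => by
      have h := germ_add M X 0 0
      rwa [add_zero, left_eq_add] at h
    obtain ⟨X, -, hX, -⟩ := exists_germ_le M _ (hA a) 0
    have ha : a ∈ fixedSubring A X.subgroup := fun h hh => hX hh
    change stalkCoeffSMul M hA a 0 = 0
    conv_lhs => rw [← h0 X]
    rw [stalkCoeffSMul_germ_self M hA a X ha, smul_zero, h0]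
  smul_add a s t := by
    obtain ⟨X, v, w, hX, rfl, rfl⟩ := exists_germ₂ M _ (hA a) s t
    have ha : a ∈ fixedSubring A X.subgroup := fun h hh => hX hh
    change stalkCoeffSMul M hA a _ = stalkCoeffSMul M hA a _ + stalkCoeffSMul M hA a _
    rw [← germ_add, stalkCoeffSMul_germ_self M hA a X ha, stalkCoeffSMul_germ_self M hA a X ha,
      stalkCoeffSMul_germ_self M hA a X ha, smul_add, germ_add]
  add_smul a b s := by
    obtain ⟨X, v, hX, rfl⟩ := exists_germ_le M
      (MulAction.stabilizer G a ⊓ MulAction.stabilizer G b) ((hA a).inter (hA b)) s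
    have ha : a ∈ fixedSubring A X.subgroup := fun h hh => (hX hh).1
    have hb : b ∈ fixedSubring A X.subgroup := fun h hh => (hX hh).2
    change stalkCoeffSMul M hA (a + b) _ = stalkCoeffSMul M hA a _ + stalkCoeffSMul M hA b _
    rw [stalkCoeffSMul_germ_self M hA b X hb, stalkCoeffSMul_germ_self M hA a X ha,
      stalkCoeffSMul_germ_self M hA (a + b) X (add_mem ha hb), ← germ_add, ← add_smul]
    rfl
  zero_smul s := by
    have h0 : ∀ X, germ M X 0 = 0 := fun X => by
      have h := germ_add M X 0 0
      rwa [add_zero, left_eq_add] at h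
    obtain ⟨X, v, rfl⟩ := exists_germ M s
    refine (stalkCoeffSMul_germ_self M hA 0 X (zero_mem _) v).trans ?_
    exact (congrArg _ (zero_smul (fixedSubring A X.subgroup) v)).trans (h0 X)

theorem smul_stalkCoeffSMul [IsTopologicalGroup G] (hA : IsDiscreteAction G A) (g : G) (a : A)
    (s : Stalk M) :
    g • stalkCoeffSMul M hA a s = stalkCoeffSMul M hA (g • a) (g • s) := by
  obtain ⟨X, v, hX, rfl⟩ := exists_germ_le M _ (hA a) s
  have ha : a ∈ fixedSubring A X.subgroup := fun h hh => hX hh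
  obtain ⟨Y, f, hf⟩ := exists_hom X (g : G ⧸ X.subgroup)
  have hga := coe_fixedSubringMap A ℋ f ⟨a, ha⟩ hf
  have hga' : g • a ∈ fixedSubring A Y.subgroup := hga ▸ (fixedSubringMap A f ⟨a, ha⟩).2
  rw [stalkCoeffSMul_germ_self M hA a X ha, smul_germ M g f hf, smul_germ M g f hf, res_smul,
    stalkCoeffSMul_germ_self M hA (g • a) Y hga']
  congr 2
  exact Subtype.ext hga

end CoeffAction

/-! #### The colimit as a discrete `AG`-module -/

section SkewModule

variable [IsTopologicalGroup G] (hA : IsDiscreteAction G A)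

/-- The ring homomorphism from `AG` to the endomorphism ring of the colimit, sending `a g` to the
endomorphism `s ↦ a • (g • s)`. -/
def stalkRingHom : SkewGroupRing G A →+* AddMonoid.End (Stalk M) :=
  letI := stalkModule M hA
  SkewMonoidAlgebra.liftNCRingHom (Module.toAddMonoidEnd A (Stalk M))
    (DistribMulAction.toAddMonoidEnd G (Stalk M))
    (fun {a g} => AddMonoidHom.ext fun s => (smul_stalkCoeffSMul M hA g a s).symm)

theorem stalkRingHom_single (g : G) (a : A) (s : Stalk M) :
    stalkRingHom M hA (SkewMonoidAlgebra.single g a) s = stalkCoeffSMul M hA a (g • s) := by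
  let := stalkModule M hA
  exact DFunLike.congr_fun (SkewMonoidAlgebra.liftNC_single
    ((Module.toAddMonoidEnd A (Stalk M) : A →+* AddMonoid.End (Stalk M)) :
      A →+ AddMonoid.End (Stalk M)) (DistribMulAction.toAddMonoidEnd G (Stalk M)) g a) s

/-- The colimit as an `AG`-module. -/
def stalkObj : ModuleCat.{u} (SkewGroupRing G A) :=
  letI : Module (SkewGroupRing G A) (Stalk M) := Module.compHom (Stalk M) (stalkRingHom M hA)
  ModuleCat.of (SkewGroupRing G A) (Stalk M)

theorem stalkObj_group_smul (g : G) (s : Stalk M) :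
    (show Stalk M from g • (show stalkObj M hA from s)) = g • s := by
  refine (stalkRingHom_single M hA g 1 s).trans ?_
  let := stalkModule M hA
  exact one_smul A (g • s)

theorem stalkObj_isDiscrete : isDiscrete G A (stalkObj M hA) := by
  intro s
  have h : (MulAction.stabilizer G s : Set G) =
      (MulAction.stabilizer G (show Stalk M from s) : Set G) := by
    ext g
    exact Eq.congr (stalkObj_group_smul M hA g s) rfl
  rw [h]
  exact stalk_isDiscreteAction M _

variable {M M'}

/-- The map of colimits induced by a morphism of presheaves of modules. -/
def stalkMap (α : M ⟶ M') : Stalk M →+ Stalk M' where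
  toFun := stalkLift M (fun X v => germ M' X (α.app (op X) v)) (fun {X Y} f hf v => by
    rw [app_res, germ_res M' f hf])
  map_zero' := by
    have h0 : ∀ (N : PresheafOfModules.{u} (structurePresheaf A ℋ)) X, germ N X 0 = 0 :=
      fun N X => by
        have h := germ_add N X 0 0
        rwa [add_zero, left_eq_add] at h
    obtain ⟨X, -, -⟩ := exists_germ M 0
    conv_lhs => rw [← h0 M X]
    rw [stalkLift_germ, map_zero, h0]
  map_add' s t := by
    obtain ⟨X, v, w, -, rfl, rfl⟩ := exists_germ₂ M ⊤ isOpen_univ s t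
    rw [← germ_add, stalkLift_germ, stalkLift_germ, stalkLift_germ, map_add, germ_add]

theorem stalkMap_germ (α : M ⟶ M') (X : OrbitCategory ℋ) (v : M.obj (op X)) :
    stalkMap α (germ M X v) = germ M' X (α.app (op X) v) := rfl

theorem stalkMap_group_smul (α : M ⟶ M') (g : G) (s : Stalk M) :
    stalkMap α (g • s) = g • stalkMap α s := by
  obtain ⟨X, v, rfl⟩ := exists_germ M s
  obtain ⟨Y, f, hf⟩ := exists_hom X (g : G ⧸ X.subgroup)
  rw [smul_germ M g f hf, stalkMap_germ, stalkMap_germ, smul_germ M' g f hf, app_res]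

theorem stalkMap_coeff_smul (α : M ⟶ M') (a : A) (s : Stalk M) :
    stalkMap α (stalkCoeffSMul M hA a s) = stalkCoeffSMul M' hA a (stalkMap α s) := by
  obtain ⟨X, v, hX, rfl⟩ := exists_germ_le M _ (hA a) s
  have ha : a ∈ fixedSubring A X.subgroup := fun h hh => hX hh
  rw [stalkCoeffSMul_germ_self M hA a X ha, stalkMap_germ, stalkMap_germ,
    stalkCoeffSMul_germ_self M' hA a X ha]
  exact congrArg _ ((α.app (op X)).hom.map_smul _ v)

theorem stalkMap_smul (α : M ⟶ M') (r : SkewGroupRing G A) (s : Stalk M) :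
    stalkMap α (stalkRingHom M hA r s) = stalkRingHom M' hA r (stalkMap α s) := by
  induction r using SkewMonoidAlgebra.induction_on with
  | zero => simp
  | single g a =>
    rw [stalkRingHom_single, stalkRingHom_single, stalkMap_coeff_smul, stalkMap_group_smul]
  | add p q hp hq =>
    rw [map_add, map_add]
    exact (map_add (stalkMap α) _ _).trans (congrArg₂ (· + ·) hp hq)

/-- The homomorphism of `AG`-modules induced on colimits. -/
def stalkHom (α : M ⟶ M') : stalkObj M hA ⟶ stalkObj M' hA :=
  ModuleCat.ofHom (X := stalkObj M hA) (Y := stalkObj M' hA)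
    { toFun := stalkMap α
      map_add' := (stalkMap α).map_add
      map_smul' := stalkMap_smul hA α }

variable (ℋ)

/-- The functor `ψ` from sheaves of `𝒜`-modules to discrete `AG`-modules, sending `M` to the
colimit of `M(G ⧸ H)` over `H ∈ ℋ`. -/
def colimitFunctor : SheafOfModules.{u} (structureSheaf A ℋ) ⥤ DiscreteModuleCat G A where
  obj M := ⟨stalkObj M.val hA, stalkObj_isDiscrete M.val hA⟩
  map α := ⟨stalkHom hA α.val⟩
  map_id M := by
    apply ObjectProperty.hom_ext
    ext (s : Stalk M.val)
    obtain ⟨X, v, rfl⟩ := exists_germ M.val s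
    rfl
  map_comp {M M' M''} α β := by
    apply ObjectProperty.hom_ext
    ext (s : Stalk M.val)
    obtain ⟨X, v, rfl⟩ := exists_germ M.val s
    rfl

end SkewModule

end Colimit

end DiscreteModules

end

noncomputable section

namespace DiscreteModules

open OrbitCategory

variable {G A : Type u} [Group G] [TopologicalSpace G] [CommRing A] [MulSemiringAction G A]
  {ℋ : CofinalSystem G}

/-! For a discrete module `V`, the colimit of the `V^H` is a directed union inside `V`. Every `v`
has an open stabilizer, which contains a member of `ℋ`, so this union is all of `V`. This gives `ψφ
≅ 𝟭`, by `stalkFixedLinear_bijective`.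

For a sheaf `M` the task is to recover `M(G/H)` as the `H`-fixed part of the colimit. Every single
morphism of the orbit category generates a covering sieve, so all restrictions of `M` are injective,
and hence so is `M(G/H) → ψ(M)` (`germ_injective`). Its image is fixed by `H`.

For the converse, represent a fixed class by `v` over some `G/L` with `L ≤ H`, and descend `v` along
`G/L → G/H`. Two morphisms into `G/L` with base points `xL` and `yL` agree over `G/H` exactly when
`x⁻¹y ∈ H`. By `smul_germ`, the two restrictions of `v` have germs `x • [v]` and `y • [v]`. These
coincide because `[v]` is `H`-fixed, so injectivity of germs gives the descent condition
(`exists_germ_of_fixed`). Thus `M(G/H) ≅ ψ(M)^H`. Since `smul_germ` also turns restriction maps into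
multiplication by group elements, the isomorphism is one of presheaves, giving `𝟭 ≅ φψ`. -/

theorem germ_eq_iff (M : PresheafOfModules.{u} (structurePresheaf A ℋ)) (X Y : OrbitCategory ℋ)
    (v : M.obj (op X)) (w : M.obj (op Y)) :
    germ M X v = germ M Y w ↔ ∃ (W : OrbitCategory ℋ) (hX : W.subgroup ≤ X.subgroup)
      (hY : W.subgroup ≤ Y.subgroup), res M (proj hX) v = res M (proj hY) w := by
  constructor
  · intro h
    -- The relation defining the direct limit identifies two elements as soon as they agree at some
    -- later index, here a smaller subgroup.
    obtain ⟨k, hi, hj, hk⟩ := Quotient.exact h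
    exact ⟨k.orbit, hi, hj, hk⟩
  · rintro ⟨W, hX, hY, h⟩
    rw [← germ_res M (proj hX) (base_proj _), h, germ_res M _ (base_proj _)]

/-! ### The canonical map from the colimit of the fixed points to the module -/

section FixedPoints

variable (V : ModuleCat.{u} (SkewGroupRing G A))

variable (ℋ) in
/-- The map from the colimit of the `V^H` to `V` induced by the inclusions. -/
def stalkFixedToModule : Stalk (fixedPresheaf ℋ V) → V :=
  stalkLift _ (fun X (v : fixedSubmodule V X.subgroup) => (v : V)) (fun f hf v =>
    ((coe_fixedSubmoduleMap V f v hf).trans (one_smul G _)).symm)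

theorem stalkFixedToModule_add (s t : Stalk (fixedPresheaf ℋ V)) :
    stalkFixedToModule ℋ V (s + t) = stalkFixedToModule ℋ V s + stalkFixedToModule ℋ V t := by
  obtain ⟨X, v, w, -, rfl, rfl⟩ := exists_germ₂ _ ⊤ isOpen_univ s t
  rw [← germ_add]
  rfl

theorem stalkFixedToModule_coeff_smul (hA : IsDiscreteAction G A) (a : A)
    (s : Stalk (fixedPresheaf ℋ V)) :
    stalkFixedToModule ℋ V (stalkCoeffSMul _ hA a s) = a • stalkFixedToModule ℋ V s := by
  obtain ⟨X, v, hX, rfl⟩ := exists_germ_le _ _ (hA a) s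
  -- With a representative over a subgroup that fixes `a`, the action is the one of `A^H` on `V^H`,
  -- inherited from `V`.
  rw [stalkCoeffSMul_germ_self _ hA a X fun h hh => hX hh]
  rfl

end FixedPoints

variable [IsTopologicalGroup G]

/-! ### Consequences of the sheaf condition for the atomic topology -/

section Sheaf

variable {M : PresheafOfModules.{u} (structurePresheaf A ℋ)}

/-- Descent for a sheaf on the atomic site along a single morphism. -/
theorem existsUnique_res_eq (hM : Presheaf.IsSheaf (atomicTopology ℋ) M.presheaf)
    {X Y : OrbitCategory ℋ} (f : X ⟶ Y) (v : M.obj (op X))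
    (hv : ∀ {Z : OrbitCategory ℋ} (p q : Z ⟶ X), p ≫ f = q ≫ f →
      res M p v = res M q v) :
    ∃! w : M.obj (op Y), res M f w = v := by
  have h : Presheaf.IsSheaf (atomicTopology ℋ) (M.presheaf ⋙ forget Ab.{u}) :=
    (Presheaf.isSheaf_iff_isSheaf_forget _ _ (forget Ab.{u})).mp hM
  rw [isSheaf_iff_isSheaf_of_type] at h
  -- The sieve generated by `f` contains `f`, so it is nonempty and hence covering. For it, the
  -- sheaf condition reduces to one about `f` alone.
  have hf := h (Sieve.generate (Presieve.singleton f))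
    ⟨X, f, Sieve.le_generate _ _ _ (Presieve.singleton_self f)⟩
  rw [← Presieve.isSheafFor_iff_generate, Presieve.isSheafFor_singleton] at hf
  exact hf v hv

/-- This is the uniqueness half of descent: a section that is already a restriction along `f`
satisfies the compatibility condition automatically. -/
theorem res_injective (hM : Presheaf.IsSheaf (atomicTopology ℋ) M.presheaf)
    {X Y : OrbitCategory ℋ} (f : X ⟶ Y) :
    Function.Injective (res M f) := by
  intro v w h
  refine (existsUnique_res_eq hM f (res M f w) fun p q hpq => ?_).unique h rfl
  rw [← res_comp, ← res_comp, hpq]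

/-- Equal germs agree after restriction to a smaller subgroup, and that restriction is injective.
Equations between sections can therefore be checked in the colimit, where the whole group acts. -/
theorem germ_injective (hM : Presheaf.IsSheaf (atomicTopology ℋ) M.presheaf)
    (X : OrbitCategory ℋ) : Function.Injective (germ M X) := by
  intro v w h
  obtain ⟨W, hX, _, hW⟩ := (germ_eq_iff M X X v w).mp h
  exact res_injective hM _ hW

/-- An element of the colimit that is fixed by `H` comes from a section over `G ⧸ H`. -/
theorem exists_germ_of_fixed (hM : Presheaf.IsSheaf (atomicTopology ℋ) M.presheaf)
    (X : OrbitCategory ℋ) (s : Stalk M)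
    (hs : ∀ h ∈ X.subgroup, h • s = s) : ∃ v : M.obj (op X), germ M X v = s := by
  obtain ⟨Y, v, hY, rfl⟩ := exists_germ_le M _ (ℋ.isOpen _ X.mem) s
  -- The representative `v` lives over a subgroup of `H`; the section sought over `G/H` is its
  -- descent along the projection.
  obtain ⟨w, hw, -⟩ := existsUnique_res_eq hM (proj hY) v fun {Z} p q hpq => by
    obtain ⟨x, hx⟩ := QuotientGroup.mk_surjective (base p)
    obtain ⟨y, hy⟩ := QuotientGroup.mk_surjective (base q)
    -- Comparing base points in `G/H` turns `hpq` into `x⁻¹ * y ∈ H`.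
    have hxy := congrArg base hpq
    rw [base_comp_of_eq _ _ hx.symm, base_comp_of_eq _ _ hy.symm, base_proj,
      MulAction.Quotient.smul_coe, MulAction.Quotient.smul_coe, smul_eq_mul, smul_eq_mul,
      mul_one, mul_one, QuotientGroup.eq] at hxy
    -- In the colimit the two restrictions become `x • [v]` and `y • [v]`, so their equality says
    -- that `x⁻¹ * y` fixes `[v]`, which is `hs`.
    apply germ_injective hM
    rw [← smul_germ M x p hx.symm, ← smul_germ M y q hy.symm, eq_comm,
      ← inv_smul_eq_iff, ← mul_smul, hs _ hxy]
  exact ⟨w, by rw [← germ_res M (proj hY) (base_proj _), hw]⟩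

end Sheaf

/-! ### The isomorphism from a sheaf to the fixed points of its colimit -/

section Unit

variable (hA : IsDiscreteAction G A)

/-- The left side acts through `A → AG`, `a ↦ a·1`, so this is `stalkRingHom_single` at the identity
of `G`. It lets the linear structure of `fixedSubmodule (stalkObj M hA) H` be computed on germs. -/
theorem stalkObj_coeff_smul (M : PresheafOfModules.{u} (structurePresheaf A ℋ)) (a : A)
    (s : Stalk M) :
    (show Stalk M from a • (show stalkObj M hA from s)) = stalkCoeffSMul M hA a s := by
  refine (stalkRingHom_single M hA 1 a s).trans ?_
  rw [one_smul]

/-- Taking germs, as an `A^H`-linear map from `M(G ⧸ H)` to the fixed points of the colimit. -/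
def germLinear (M : PresheafOfModules.{u} (structurePresheaf A ℋ)) (X : OrbitCategory ℋ) :
    M.obj (op X) →ₗ[fixedSubring A X.subgroup] fixedSubmodule (stalkObj M hA) X.subgroup where
  toFun v := ⟨germ M X v, fun h hh =>
    (stalkObj_group_smul M hA h _).trans (smul_germ_of_mem M hh v)⟩
  map_add' v w := Subtype.ext (germ_add M X v w)
  map_smul' a v := Subtype.ext
    ((stalkCoeffSMul_germ_self M hA a X a.2 v).symm.trans (stalkObj_coeff_smul hA M a _).symm)

/-- The two halves of the sheaf condition appear here: uniqueness of descent gives injectivity, and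
its existence gives surjectivity. -/
theorem germLinear_bijective (M : SheafOfModules.{u} (structureSheaf A ℋ))
    (X : OrbitCategory ℋ) : Function.Bijective (germLinear hA M.val X) := by
  constructor
  · intro v w h
    exact germ_injective M.isSheaf X (congrArg Subtype.val h)
  · rintro ⟨s, hs⟩
    -- `hs` concerns the action of `G` obtained from the `AG`-module structure;
    -- `stalkObj_group_smul` translates it to the action defined directly on the colimit.
    obtain ⟨v, hv⟩ := exists_germ_of_fixed M.isSheaf X s fun h hh =>
      (stalkObj_group_smul M.val hA h s).symm.trans (hs h hh)
    exact ⟨v, Subtype.ext hv⟩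

/-- A sheaf of `𝒜`-modules is isomorphic to the presheaf of fixed points of its colimit. -/
def germIso (M : SheafOfModules.{u} (structureSheaf A ℋ)) :
    M.val ≅ fixedPresheaf ℋ (stalkObj M.val hA) :=
  PresheafOfModules.isoMk
    (fun X => (LinearEquiv.ofBijective _ (germLinear_bijective hA M X.unop)).toModuleIso)
    (fun X Y f => by
      ext (v : M.val.obj X)
      apply Subtype.ext
      obtain ⟨x, hx⟩ := QuotientGroup.mk_surjective (base f.unop)
      -- If `f` has base point `x`, the fixed-point presheaf restricts along `f` by multiplication
      -- by `x`. By `smul_germ`, this is also the effect on germs of restriction in `M`.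
      refine Eq.trans ?_ (coe_fixedSubmoduleMap (stalkObj M.val hA) f.unop
        (germLinear hA M.val X.unop v) hx.symm).symm
      exact ((stalkObj_group_smul M.val hA x _).trans
        (smul_germ M.val x f.unop hx.symm v)).symm)

variable (ℋ) in
/-- The identity functor is isomorphic to `ψ` followed by `φ`. -/
def germNatIso : 𝟭 (SheafOfModules.{u} (structureSheaf A ℋ)) ≅
    colimitFunctor ℋ hA ⋙ fixedPointsFunctor ℋ :=
  NatIso.ofComponents
    -- Sheaves of modules form a full subcategory of presheaves of modules, so the isomorphism of
    -- underlying presheaves suffices.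
    (fun M => (SheafOfModules.fullyFaithfulForget _).preimageIso (germIso hA M))
    (fun _ => rfl)

end Unit

/-! ### The isomorphism from the colimit of the fixed points to a discrete module -/

section Counit

variable (V : ModuleCat.{u} (SkewGroupRing G A))

/-- The group acts on germs by restriction along a morphism with base point `gH`, and for the
fixed-point presheaf that restriction is `v ↦ g • v`. -/
theorem stalkFixedToModule_group_smul (g : G) (s : Stalk (fixedPresheaf ℋ V)) :
    stalkFixedToModule ℋ V (g • s) = g • stalkFixedToModule ℋ V s := by
  obtain ⟨X, v, rfl⟩ := exists_germ _ s
  obtain ⟨Y, f, hf⟩ := exists_hom X (g : G ⧸ X.subgroup)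
  rw [smul_germ _ g f hf]
  exact coe_fixedSubmoduleMap V f v hf

variable (hA : IsDiscreteAction G A)

/-- The skew group ring is additively generated by the elements `a g`, and these act on both sides
as `g` followed by `a`. -/
theorem stalkFixedToModule_smul (r : SkewGroupRing G A) (s : Stalk (fixedPresheaf ℋ V)) :
    stalkFixedToModule ℋ V (stalkRingHom _ hA r s) = r • stalkFixedToModule ℋ V s := by
  induction r using SkewMonoidAlgebra.induction_on with
  | zero =>
    rw [map_zero, zero_smul]
    -- The map is so far only a function known to be additive; that it preserves zero follows by
    -- cancelling in `f 0 = f 0 + f 0`.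
    have h := stalkFixedToModule_add V (0 : Stalk (fixedPresheaf ℋ V)) 0
    rwa [add_zero, left_eq_add] at h
  | single g a =>
    rw [stalkRingHom_single, stalkFixedToModule_coeff_smul, stalkFixedToModule_group_smul,
      single_smul_eq]
  | add p q hp hq =>
    rw [map_add, add_smul, ← hp, ← hq]
    exact stalkFixedToModule_add V _ _

variable (ℋ) in
/-- `stalkFixedToModule` as a homomorphism of `AG`-modules. -/
def stalkFixedLinear : stalkObj (fixedPresheaf ℋ V) hA →ₗ[SkewGroupRing G A] V where
  toFun := stalkFixedToModule ℋ V
  map_add' := stalkFixedToModule_add V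
  map_smul' := stalkFixedToModule_smul V hA

theorem stalkFixedLinear_bijective (hV : IsDiscreteAction G V) :
    Function.Bijective (stalkFixedLinear ℋ V hA) := by
  constructor
  · intro (s : Stalk _) (t : Stalk _) h
    -- Over a common subgroup both classes are elements of the same `V^H`, which is included in `V`.
    obtain ⟨X, v, w, -, rfl, rfl⟩ := exists_germ₂ _ ⊤ isOpen_univ s t
    exact congrArg (germ (fixedPresheaf ℋ V) X) (Subtype.ext h)
  · intro v
    -- Discreteness of `V` enters here: the stabilizer of `v` is open, so `v` lies in `V^H` for some
    -- `H` in `ℋ`.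
    obtain ⟨X, hX⟩ := exists_le (ℋ := ℋ) _ (hV v)
    exact ⟨germ (fixedPresheaf ℋ V) X (⟨v, fun h hh => hX hh⟩ : fixedSubmodule V X.subgroup), rfl⟩

variable (ℋ) in
/-- `φ` followed by `ψ` is isomorphic to the identity functor. -/
def stalkFixedNatIso :
    fixedPointsFunctor ℋ ⋙ colimitFunctor ℋ hA ≅ 𝟭 (DiscreteModuleCat G A) :=
  NatIso.ofComponents
    (fun V => (isDiscrete G A).isoMk
      (LinearEquiv.ofBijective _ (stalkFixedLinear_bijective V.obj hA V.property)).toModuleIso)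
    (fun {V W} α => by
      apply ObjectProperty.hom_ext
      ext (s : Stalk (fixedPresheaf ℋ V.obj))
      -- On the germ of `v` both composites are `α v` by definition.
      obtain ⟨X, v, rfl⟩ := exists_germ _ s
      rfl)

end Counit

end DiscreteModules

end

theorem mainTheorem5 {G A : Type u} [Group G] [TopologicalSpace G] [IsTopologicalGroup G]
    [CommRing A] [MulSemiringAction G A] (hA : DiscreteModules.IsDiscreteAction G A)
    (ℋ : DiscreteModules.CofinalSystem G) :
    ∃ e : DiscreteModules.DiscreteModuleCat G A ≌
        SheafOfModules.{u} (DiscreteModules.structureSheaf A ℋ),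
      e.functor = DiscreteModules.fixedPointsFunctor ℋ ∧
        e.inverse = DiscreteModules.colimitFunctor ℋ hA :=
  -- `Equivalence.mk` adjusts the unit so that the triangle identity holds, so none has to be
  -- checked. It leaves the two functors untouched, hence the two `rfl`s.
  ⟨CategoryTheory.Equivalence.mk _ _ (DiscreteModules.stalkFixedNatIso ℋ hA).symm
    (DiscreteModules.germNatIso ℋ hA).symm, rfl, rfl⟩
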